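/- **Theorem 3.1 (Admissible $s$ and $A$).** Let $n\ge 1$ be an integer, let $s\in(0,\infty)\setminus\mathbb N$, with integer part $[s]$ and fractional part $\{s\}=s-[s]$, and let $A:[0,\infty)\to[0,\infty]$ be a Young function, i.e. a convex, left-continuous function with $A(0)=0$ which is neither identically $0$ nor identically $\infty$ on $(0,\infty)$. For $\sigma\in(0,1)$ and a (possibly vector-valued) measurable function $w$ on $\mathbb R^n$ set $$J_{\sigma,A}(w)=\int_{\mathbb R^n}\int_{\mathbb R^n}A\left(\frac{|w(x)-w(y)|}{|x-y|^{\sigma}}\right)\frac{dx\,dy}{|x-y|^n},\qquad |w|_{\sigma,A,\mathbb R^n}=\inf\{\lambda>0: J_{\sigma,A}(w/\lambda)\le 1\}\quad(\inf\emptyset=\infty).$$ Let $V_d^{s,A}(\mathbb R^n)$ be the space of all measurable functions $u:\mathbb R^n\to\mathbb R$ that are $[s]$-times weakly differentiable (no condition if $[s]=0$), satisfy $\big|\nabla^{[s]}u\big|_{\{s\},A,\mathbb R^n}<\infty$, and are such that the Lebesgue measure of $\{|\nabla^k u|>t\}$ is finite for every $t>0$ and every $k=0,1,\dots,[s]$.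 Here, $\nabla^k u$ is the vector of all weak derivatives of $u$ of order $k$, with its Euclidean norm, and $\nabla^0u=u$. A rearrangement-invariant space $Y(\mathbb R^n)$ is a Banach function space in the sense of Luxemburg, over $\mathbb R^n$ with Lebesgue measure, such that $\|u\|_{Y(\mathbb R^n)}=\|v\|_{Y(\mathbb R^n)}$ whenever $u^*=v^*$, where $u^*(r)=\inf\{t\ge0:|\{|u|>t\}|\le r\}$ for $r\ge 0$. Assume that the continuous embedding $V_d^{s,A}(\mathbb R^n)\to Y(\mathbb R^n)$ holds for some rearrangement-invariant space $Y(\mathbb R^n)$, namely that $V_d^{s,A}(\mathbb R^n)\subset Y(\mathbb R^n)$ and there exists a constant $c$ such that $\|u\|_{Y(\mathbb R^n)}\le c\,\big|\nabla^{[s]}u\big|_{\{s\},A,\mathbb R^n}$ for every $u\in V_d^{s,A}(\mathbb R^n)$. Then $$s<n\qquad\text{and}\qquad \int_0^{\delta}\left(\frac{t}{A(t)}\right)^{\frac{s}{n-s}}dt<\infty\quad\text{for some }\delta>0,$$ where $t/A(t)$ is taken to be $\infty$ if $A(t)=0$, and $0$ if $A(t)=\infty$. -/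

import Mathlib

open MeasureTheory Filter Topology
open scoped NNReal ENNReal

noncomputable section

namespace FracOrlicz

/-- The Euclidean space `ℝⁿ`. -/
abbrev Eucl (n : ℕ) : Type := EuclideanSpace ℝ (Fin n)

/-- Young functions `A : [0, ∞) → [0, ∞]`: convex, left-continuous, `A(0) = 0`, and neither
identically `0` nor identically `∞` on `(0, ∞)`. -/
structure IsYoung (A : ℝ≥0 → ℝ≥0∞) : Prop where
  convex : ConvexOn ℝ≥0 Set.univ A
  left_continuous : ∀ t, ContinuousWithinAt A (Set.Iic t) t
  map_zero : A 0 = 0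
  ne_zero : ∃ t, A t ≠ 0
  ne_top : ∃ t, 0 < t ∧ A t ≠ ∞

/-! ### Rearrangement-invariant spaces -/

/-- A (Luxemburg) Banach function norm `ρ` over a measure space, on `[0, ∞]`-valued measurable
functions. As usual, "measurable" means measurable for the completed measure, and functions that
agree almost everywhere are not distinguished (which follows from `mono`). -/
structure BanachFunctionNorm {Ω : Type*} [MeasurableSpace Ω] (μ : Measure Ω) where
  /-- the function norm -/
  norm : (Ω → ℝ≥0∞) → ℝ≥0∞
  norm_eq_zero : ∀ f, AEMeasurable f μ → (norm f = 0 ↔ f =ᵐ[μ] 0)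
  norm_smul : ∀ (c : ℝ≥0) (f), AEMeasurable f μ → norm (fun x => c * f x) = c * norm f
  norm_add : ∀ f g, AEMeasurable f μ → AEMeasurable g μ →
    norm (fun x => f x + g x) ≤ norm f + norm g
  mono : ∀ f g, AEMeasurable f μ → AEMeasurable g μ → f ≤ᵐ[μ] g → norm f ≤ norm g
  fatou : ∀ (f : ℕ → Ω → ℝ≥0∞) (g : Ω → ℝ≥0∞), (∀ k, AEMeasurable (f k) μ) → AEMeasurable g μ →
    (∀ᵐ x ∂μ, Monotone (fun k => f k x) ∧ Tendsto (fun k => f k x) atTop (𝓝 (g x))) →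
    Tendsto (fun k => norm (f k)) atTop (𝓝 (norm g))
  norm_indicator : ∀ E, MeasurableSet E → μ E < ∞ → norm (E.indicator fun _ => 1) < ∞
  integral_le : ∀ E, MeasurableSet E → μ E < ∞ →
    ∃ C : ℝ≥0, ∀ f, AEMeasurable f μ → ∫⁻ x in E, f x ∂μ ≤ C * norm f

/-- The decreasing rearrangement `f*(r) = inf {t ≥ 0 : |{f > t}| ≤ r}`, for `r ≥ 0`. -/
def rearrangement {Ω : Type*} [MeasurableSpace Ω] (μ : Measure Ω) (f : Ω → ℝ≥0∞) (r : ℝ≥0) :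
    ℝ≥0∞ :=
  sInf {t : ℝ≥0∞ | μ {x | t < f x} ≤ r}

/-- A rearrangement-invariant space over `ℝⁿ` with the Lebesgue measure, given by its
function norm. -/
structure RISpace (n : ℕ) extends BanachFunctionNorm (volume : Measure (Eucl n)) where
  rearrangement_invariant : ∀ f g, AEMeasurable f volume → AEMeasurable g volume →
    rearrangement volume f = rearrangement volume g → norm f = norm g

/-- The norm `‖u‖_{Y(ℝⁿ)}` of a function `u : ℝⁿ → ℝ`, equal to `∞` if `u ∉ Y(ℝⁿ)`. -/
def RISpace.normFun {n : ℕ} (Y : RISpace n) (u : Eucl n → ℝ) : ℝ≥0∞ :=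
  Y.norm (fun x => ‖u x‖ₑ)

/-- Membership of a function in the space `Y(ℝⁿ)`. -/
def RISpace.Mem {n : ℕ} (Y : RISpace n) (u : Eucl n → ℝ) : Prop :=
  AEMeasurable u volume ∧ Y.normFun u < ∞

/-! ### Weak derivatives -/

/-- The classical partial derivative `∂φ/∂xᵢ`. -/
def partialDeriv {n : ℕ} (i : Fin n) (φ : Eucl n → ℝ) : Eucl n → ℝ :=
  fun x => lineDeriv ℝ φ x (EuclideanSpace.single i 1)

/-- The classical derivative `∂^α φ = ∂₁^{α₁} ⋯ ∂ₙ^{αₙ} φ` for a multi-index `α`. -/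
def multiDeriv {n : ℕ} (α : Fin n → ℕ) (φ : Eucl n → ℝ) : Eucl n → ℝ :=
  (List.finRange n).foldr (fun i ψ => (partialDeriv i)^[α i] ψ) φ

/-- The function `v` is the weak derivative of `u` on `ℝⁿ` for the multi-index `α`. -/
def HasWeakDeriv {n : ℕ} (α : Fin n → ℕ) (u v : Eucl n → ℝ) : Prop :=
  LocallyIntegrable u volume ∧ LocallyIntegrable v volume ∧
    ∀ φ : Eucl n → ℝ, ContDiff ℝ (⊤ : ℕ∞) φ → HasCompactSupport φ →
      ∫ x, u x * multiDeriv α φ x = (-1) ^ (∑ i, α i) * ∫ x, v x * φ x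

/-- `u` is `m`-times weakly differentiable: all its weak derivatives of order `1, …, m` exist. -/
def WeaklyDiff {n : ℕ} (m : ℕ) (u : Eucl n → ℝ) : Prop :=
  ∀ α : Fin n → ℕ, 1 ≤ ∑ i, α i → ∑ i, α i ≤ m → ∃ v, HasWeakDeriv α u v

open Classical in
/-- The weak derivative of `u` for the multi-index `α`, unique up to null sets when it exists
(and `0` when it does not). The derivative of order `0` is `u` itself, also if `u` is not locally
integrable. -/
def weakDeriv {n : ℕ} (α : Fin n → ℕ) (u : Eucl n → ℝ) : Eucl n → ℝ :=
  if α = 0 then u else if h : ∃ v, HasWeakDeriv α u v then h.choose else 0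

/-- The finite set of the multi-indices `α` with `|α| = k`. -/
abbrev multiIndices (n k : ℕ) : Finset (Fin n → ℕ) :=
  Finset.piAntidiag (Finset.univ : Finset (Fin n)) k

/-- The vector `∇ᵏu` of all weak derivatives of `u` of order `k`, with the Euclidean norm on
vectors. -/
def weakGrad {n : ℕ} (k : ℕ) (u : Eucl n → ℝ) (x : Eucl n) :
    EuclideanSpace ℝ (multiIndices n k) :=
  WithLp.toLp 2 (fun α => weakDeriv (α : Fin n → ℕ) u x)

/-! ### Fractional Orlicz–Sobolev spaces -/

/-- The functional
`J_{σ,A}(w) = ∫∫ A(|w(x) - w(y)| / |x - y|^σ) dx dy / |x - y|ⁿ` for a vector-valued `w`. -/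
def fracModular {n : ℕ} {F : Type*} [NormedAddCommGroup F] (σ : ℝ) (A : ℝ≥0 → ℝ≥0∞)
    (w : Eucl n → F) : ℝ≥0∞ :=
  ∫⁻ x, ∫⁻ y, A (‖w x - w y‖₊ / ‖x - y‖₊ ^ σ) / ‖x - y‖ₑ ^ n

/-- The seminorm `|w|_{σ,A,ℝⁿ} = inf {l > 0 : J_{σ,A}(w / l) ≤ 1}` (where `inf ∅ = ∞`). -/
def fracSeminorm {n : ℕ} {F : Type*} [NormedAddCommGroup F] [NormedSpace ℝ F] (σ : ℝ)
    (A : ℝ≥0 → ℝ≥0∞) (w : Eucl n → F) : ℝ≥0∞ :=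
  ⨅ (l : ℝ≥0) (_ : 0 < l) (_ : fracModular σ A (fun x => (l : ℝ)⁻¹ • w x) ≤ 1), (l : ℝ≥0∞)

/-- The seminorm `|∇^{[s]}u|_{{s},A,ℝⁿ}`, with `[s]` and `{s}` the integer and the fractional
part of `s`. -/
def sobolevSeminorm {n : ℕ} (s : ℝ) (A : ℝ≥0 → ℝ≥0∞) (u : Eucl n → ℝ) : ℝ≥0∞ :=
  fracSeminorm (Int.fract s) A (weakGrad ⌊s⌋₊ u)

/-- The homogeneous fractional Orlicz–Sobolev space `V^{s,A}(ℝⁿ)`. -/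
def spaceV (n : ℕ) (s : ℝ) (A : ℝ≥0 → ℝ≥0∞) : Set (Eucl n → ℝ) :=
  {u | AEMeasurable u volume ∧ WeaklyDiff ⌊s⌋₊ u ∧ sobolevSeminorm s A u < ∞}

/-- The space `V_d^{s,A}(ℝⁿ)` of the functions in `V^{s,A}(ℝⁿ)` that decay near infinity,
together with their weak derivatives up to the order `[s]`. -/
def spaceVd (n : ℕ) (s : ℝ) (A : ℝ≥0 → ℝ≥0∞) : Set (Eucl n → ℝ) :=
  {u | u ∈ spaceV n s A ∧
    ∀ k ≤ ⌊s⌋₊, ∀ t : ℝ, 0 < t → volume {x | t < ‖weakGrad k u x‖} < ∞}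

/-- The continuous embedding `V_d^{s,A}(ℝⁿ) → Y(ℝⁿ)`. -/
def Embeds {n : ℕ} (s : ℝ) (A : ℝ≥0 → ℝ≥0∞) (Y : RISpace n) : Prop :=
  ∃ c : ℝ≥0, ∀ u ∈ spaceVd n s A, Y.Mem u ∧ Y.normFun u ≤ c * sobolevSeminorm s A u

end FracOrlicz

end

/-! The embedding is tested on the functions `u(x) = ∑ b_k 2^{sk} φ(2^{-k} x)`, `k < N`, `b_k ≥ 0`,
where `φ` is a smooth bump equal to `1` on the unit ball. On that ball every dilation equals `1`, so
`u` is the constant `∑ b_k 2^{sk}` there. Since `Y` controls the `L¹` norm on the ball, this sum is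
bounded by a multiple of the seminorm of `u`.

Put `m = [s]`, `σ = {s}`, `Φ = ∇^m φ`. The terms of `∇^m u` are `b_k 2^{kσ} Φ(2^{-k} x)`, so its
difference quotient is at most `∑ b_k G(2^{-k}x, 2^{-k}y)`, with `G` the difference quotient of `Φ`.
As `G` is at most a multiple of `min(r^{1-σ}, r^{-σ})`, `r = |x - y|`, the dilates of `G` have a
uniformly bounded sum (`IsBumpLike.exists_sum_diffQuot_le`). They thus serve as Jensen weights, and
the modular is controlled by `∑ A(b_k) 2^{kn}` (`fracModular_sum_le_one`). The outcome is
`DiscreteBound`: if `∑ A(b_k) 2^{kn} ≤ 1`, then `∑ b_k 2^{sk} ≤ C`.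

A single term of this inequality forces `s ≤ n`. For the integral, let `τ_k` be the supremum of the
`t` with `A(t)/t ≤ (C+1)^{-1} 2^{-k(n-s)}`. Then `∑ τ_k 2^{sk} < ∞` (`DiscreteBound.sum_sSup_le`),
and a dyadic decomposition over the values of `t/A(t)` bounds the integral by this series. -/

namespace FracOrlicz

/-! ### Classical and weak derivatives of test functions -/

/-- Smooth functions with compact support. -/
structure IsTest {n : ℕ} (φ : Eucl n → ℝ) : Prop where
  smooth : ContDiff ℝ (⊤ : ℕ∞) φ
  compact : HasCompactSupport φ

section Derivatives

variable {n : ℕ}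

theorem IsTest.differentiable {φ : Eucl n → ℝ} (h : IsTest φ) : Differentiable ℝ φ :=
  h.smooth.differentiable (by simp)

theorem partialDeriv_eq_fderiv {φ : Eucl n → ℝ} (h : IsTest φ) (i : Fin n) :
    partialDeriv i φ = fun x => fderiv ℝ φ x (EuclideanSpace.single i 1) :=
  funext fun x => (h.differentiable x).lineDeriv_eq_fderiv

theorem IsTest.partialDeriv {φ : Eucl n → ℝ} (h : IsTest φ) (i : Fin n) :
    IsTest (partialDeriv i φ) := by
  rw [partialDeriv_eq_fderiv h]
  exact ⟨(h.smooth.fderiv_right (m := (⊤ : ℕ∞)) (by simp)).clm_apply contDiff_const,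
    h.compact.fderiv_apply ℝ _⟩

theorem IsTest.iterate_partialDeriv {φ : Eucl n → ℝ} (h : IsTest φ) (i : Fin n) (m : ℕ) :
    IsTest ((FracOrlicz.partialDeriv i)^[m] φ) := by
  induction m with
  | zero => exact h
  | succ m ih => rw [Function.iterate_succ_apply']; exact ih.partialDeriv i

theorem IsTest.integrable_mul {φ ψ : Eucl n → ℝ} (hφ : IsTest φ) (hψ : IsTest ψ) :
    Integrable (fun x => φ x * ψ x) volume :=
  (hφ.smooth.continuous.mul hψ.smooth.continuous).integrable_of_hasCompactSupport
    hφ.compact.mul_right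

theorem integral_mul_partialDeriv {u φ : Eucl n → ℝ} (hu : IsTest u) (hφ : IsTest φ)
    (i : Fin n) :
    ∫ x, u x * partialDeriv i φ x = -∫ x, partialDeriv i u x * φ x := by
  have h1 := (hu.partialDeriv i).integrable_mul hφ
  have h2 := hu.integrable_mul (hφ.partialDeriv i)
  rw [partialDeriv_eq_fderiv hu] at h1 ⊢
  rw [partialDeriv_eq_fderiv hφ] at h2 ⊢
  exact integral_mul_fderiv_eq_neg_fderiv_mul_of_integrable h1 h2 (hu.integrable_mul hφ)
    (fun x _ => hu.differentiable x) (fun x _ => hφ.differentiable x)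

theorem integral_mul_iterate_partialDeriv {u φ : Eucl n → ℝ} (hu : IsTest u) (hφ : IsTest φ)
    (i : Fin n) (m : ℕ) :
    ∫ x, u x * (partialDeriv i)^[m] φ x = (-1) ^ m * ∫ x, (partialDeriv i)^[m] u x * φ x := by
  induction m generalizing u with
  | zero => simp
  | succ m ih =>
    rw [Function.iterate_succ_apply', Function.iterate_succ_apply,
      integral_mul_partialDeriv hu (hφ.iterate_partialDeriv i m), ih (hu.partialDeriv i)]
    ring

/-- Iterated partial derivatives, the first entries of the list being differentiated first. -/
noncomputable def listDeriv (α : Fin n → ℕ) (l : List (Fin n)) (u : Eucl n → ℝ) : Eucl n → ℝ :=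
  l.foldl (fun ψ i => (partialDeriv i)^[α i] ψ) u

theorem IsTest.listDeriv {u : Eucl n → ℝ} (hu : IsTest u) (α : Fin n → ℕ) (l : List (Fin n)) :
    IsTest (listDeriv α l u) := by
  induction l generalizing u with
  | nil => exact hu
  | cons i l ih => exact ih (hu.iterate_partialDeriv i (α i))

theorem IsTest.foldr_partialDeriv {φ : Eucl n → ℝ} (hφ : IsTest φ) (α : Fin n → ℕ)
    (l : List (Fin n)) :
    IsTest (l.foldr (fun i ψ => (FracOrlicz.partialDeriv i)^[α i] ψ) φ) := by
  induction l with
  | nil => exact hφ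
  | cons i l ih => exact ih.iterate_partialDeriv i (α i)

/-- Integration by parts removes the outermost derivative of `φ` first, so the derivatives reach `u`
in reverse order. Working with that order avoids any appeal to the symmetry of mixed derivatives. -/
theorem integral_mul_foldr_partialDeriv {u φ : Eucl n → ℝ} (hu : IsTest u) (hφ : IsTest φ)
    (α : Fin n → ℕ) (l : List (Fin n)) :
    ∫ x, u x * l.foldr (fun i ψ => (partialDeriv i)^[α i] ψ) φ x =
      (-1) ^ (l.map α).sum * ∫ x, listDeriv α l u x * φ x := by
  induction l generalizing u with
  | nil => simp [listDeriv]
  | cons i l ih =>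
    rw [List.foldr_cons, integral_mul_iterate_partialDeriv hu (hφ.foldr_partialDeriv α l),
      ih (hu.iterate_partialDeriv i (α i)), List.map_cons, List.sum_cons, pow_add, mul_assoc]
    rfl

theorem sum_map_finRange (α : Fin n → ℕ) : ((List.finRange n).map α).sum = ∑ i, α i := by
  rw [← List.ofFn_eq_map, List.sum_ofFn]

/-- The classical derivative of a test function, in the order opposite to that of
`multiDeriv`. -/
noncomputable def revDeriv (α : Fin n → ℕ) (u : Eucl n → ℝ) : Eucl n → ℝ :=
  listDeriv α (List.finRange n) u

theorem IsTest.revDeriv {u : Eucl n → ℝ} (hu : IsTest u) (α : Fin n → ℕ) :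
    IsTest (revDeriv α u) :=
  hu.listDeriv α _

theorem IsTest.locallyIntegrable {u : Eucl n → ℝ} (hu : IsTest u) :
    LocallyIntegrable u volume :=
  hu.smooth.continuous.locallyIntegrable

theorem IsTest.hasWeakDeriv {u : Eucl n → ℝ} (hu : IsTest u) (α : Fin n → ℕ) :
    HasWeakDeriv α u (FracOrlicz.revDeriv α u) := by
  refine ⟨hu.locallyIntegrable, (hu.revDeriv α).locallyIntegrable, fun φ h1 h2 => ?_⟩
  rw [← sum_map_finRange]
  exact integral_mul_foldr_partialDeriv hu ⟨h1, h2⟩ α _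

theorem HasWeakDeriv.ae_eq {α : Fin n → ℕ} {u v w : Eucl n → ℝ} (hv : HasWeakDeriv α u v)
    (hw : HasWeakDeriv α u w) : v =ᵐ[volume] w := by
  refine ae_eq_of_integral_contDiff_smul_eq hv.2.1 hw.2.1 fun g h1 h2 => ?_
  have h := (hv.2.2 g h1 h2).symm.trans (hw.2.2 g h1 h2)
  have h' := mul_left_cancel₀ (pow_ne_zero _ (by norm_num)) h
  simpa only [smul_eq_mul, mul_comm] using h'

theorem listDeriv_zero (l : List (Fin n)) (u : Eucl n → ℝ) : listDeriv 0 l u = u := by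
  induction l with
  | nil => rfl
  | cons i l ih => exact ih

/-- `weakDeriv` is an arbitrary choice among weak derivatives, so by uniqueness it is known only
almost everywhere. -/
theorem IsTest.weakDeriv_ae_eq {u : Eucl n → ℝ} (hu : IsTest u) (α : Fin n → ℕ) :
    weakDeriv α u =ᵐ[volume] FracOrlicz.revDeriv α u := by
  unfold weakDeriv
  split_ifs with h0 h
  · subst h0
    exact Filter.EventuallyEq.of_eq (listDeriv_zero _ u).symm
  · exact h.choose_spec.ae_eq (hu.hasWeakDeriv α)
  · exact absurd ⟨_, hu.hasWeakDeriv α⟩ h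

/-- The vector of all classical derivatives of order `m` of a test function. -/
noncomputable def revGrad (m : ℕ) (u : Eucl n → ℝ) (x : Eucl n) :
    EuclideanSpace ℝ (multiIndices n m) :=
  WithLp.toLp 2 (fun α => revDeriv (α : Fin n → ℕ) u x)

theorem IsTest.weakGrad_ae_eq {u : Eucl n → ℝ} (hu : IsTest u) (m : ℕ) :
    weakGrad m u =ᵐ[volume] revGrad m u := by
  have h : ∀ᵐ x ∂(volume : Measure (Eucl n)), ∀ α : multiIndices n m,
      weakDeriv (α : Fin n → ℕ) u x = FracOrlicz.revDeriv (α : Fin n → ℕ) u x :=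
    ae_all_iff.2 fun α => hu.weakDeriv_ae_eq _
  filter_upwards [h] with x hx
  simp only [weakGrad, revGrad, hx]

theorem IsTest.contDiff_revGrad {u : Eucl n → ℝ} (hu : IsTest u) (m : ℕ) :
    ContDiff ℝ (⊤ : ℕ∞) (revGrad m u) :=
  (contDiff_euclidean (𝕜 := ℝ)).2 fun α => (hu.revDeriv (α : Fin n → ℕ)).smooth

theorem IsTest.exists_revGrad_eq_zero {u : Eucl n → ℝ} (hu : IsTest u) (m : ℕ) :
    ∃ R : ℝ, ∀ x, R ≤ ‖x‖ → revGrad m u x = 0 := by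
  have h (α : multiIndices n m) :
      ∃ R : ℝ, ∀ x, R ≤ ‖x‖ → FracOrlicz.revDeriv (α : Fin n → ℕ) u x = 0 := by
    obtain ⟨R, -, hR⟩ := (hu.revDeriv (α : Fin n → ℕ)).compact.exists_pos_le_norm
    exact ⟨R, hR⟩
  choose R hR using h
  refine ⟨∑ α, |R α|, fun x hx => ?_⟩
  ext α
  refine hR α x (le_trans ?_ hx)
  exact (le_abs_self _).trans
    (Finset.single_le_sum (f := fun β => |R β|) (fun _ _ => abs_nonneg _) (Finset.mem_univ α))

theorem IsTest.weaklyDiff {u : Eucl n → ℝ} (hu : IsTest u) (m : ℕ) : WeaklyDiff m u :=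
  fun α _ _ => ⟨_, hu.hasWeakDeriv α⟩

theorem IsTest.volume_weakGrad_lt_top {u : Eucl n → ℝ} (hu : IsTest u) (m : ℕ) {t : ℝ}
    (ht : 0 < t) : volume {x | t < ‖weakGrad m u x‖} < ∞ := by
  obtain ⟨R, hR⟩ := hu.exists_revGrad_eq_zero m
  have h : volume {x | t < ‖weakGrad m u x‖} ≤ volume (Metric.ball (0 : Eucl n) R) := by
    refine measure_mono_ae ?_
    filter_upwards [hu.weakGrad_ae_eq m] with x hx hx'
    change x ∈ Metric.ball (0 : Eucl n) R
    rw [mem_ball_zero_iff]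
    by_contra! hle
    change t < ‖weakGrad m u x‖ at hx'
    rw [hx, hR x hle, norm_zero] at hx'
    exact lt_asymm ht hx'
  exact h.trans_lt measure_ball_lt_top

/-! ### Superpositions of dilations -/

/-- The superposition `∑ aₖ ψ(cₖ x)` of dilations of `ψ`. -/
noncomputable def dilSum {ι : Type*} (S : Finset ι) (a c : ι → ℝ) (ψ : Eucl n → ℝ)
    (x : Eucl n) : ℝ :=
  ∑ k ∈ S, a k * ψ (c k • x)

variable {ι : Type*} (S : Finset ι) (a c : ι → ℝ)

theorem IsTest.dilSum {ψ : Eucl n → ℝ} (h : IsTest ψ) (hc : ∀ k, c k ≠ 0) :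
    IsTest (dilSum S a c ψ) := by
  refine ⟨ContDiff.sum fun k _ => contDiff_const.mul (h.smooth.comp (contDiff_const_smul _)), ?_⟩
  classical
  unfold FracOrlicz.dilSum
  induction S using Finset.induction_on with
  | empty => exact HasCompactSupport.zero
  | insert k S hk ih =>
    simp only [Finset.sum_insert hk]
    exact ((h.compact.comp_smul (hc k)).mul_left (f := fun _ => a k)).add ih

theorem partialDeriv_dilSum {ψ : Eucl n → ℝ} (h : IsTest ψ) (i : Fin n) :
    partialDeriv i (dilSum S a c ψ) = dilSum S (fun k => a k * c k) c (partialDeriv i ψ) := by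
  funext x
  refine HasLineDerivAt.lineDeriv ?_
  have key : HasFDerivAt (dilSum S a c ψ)
      (∑ k ∈ S, a k • ((fderiv ℝ ψ (c k • x)).comp (c k • ContinuousLinearMap.id ℝ (Eucl n)))) x := by
    unfold dilSum
    refine HasFDerivAt.fun_sum fun k _ => HasFDerivAt.const_mul ?_ (a k)
    exact (h.differentiable (c k • x)).hasFDerivAt.comp x ((hasFDerivAt_id x).const_smul (c k))
  have h' := key.hasLineDerivAt (EuclideanSpace.single i 1)
  have e : (∑ k ∈ S, a k • ((fderiv ℝ ψ (c k • x)).comp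
      (c k • ContinuousLinearMap.id ℝ (Eucl n)))) (EuclideanSpace.single i 1) =
      dilSum S (fun k => a k * c k) c (partialDeriv i ψ) x := by
    rw [partialDeriv_eq_fderiv h]
    simp [dilSum, mul_assoc]
  rwa [e] at h'

theorem iterate_partialDeriv_dilSum {ψ : Eucl n → ℝ} (h : IsTest ψ) (i : Fin n) (m : ℕ) :
    (partialDeriv i)^[m] (dilSum S a c ψ) =
      dilSum S (fun k => a k * c k ^ m) c ((partialDeriv i)^[m] ψ) := by
  induction m generalizing a ψ with
  | zero => simp
  | succ m ih =>
    rw [Function.iterate_succ_apply, Function.iterate_succ_apply, partialDeriv_dilSum S a c h,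
      ih _ (h.partialDeriv i)]
    simp only [pow_succ', mul_assoc]

theorem listDeriv_dilSum {ψ : Eucl n → ℝ} (h : IsTest ψ) (α : Fin n → ℕ) (l : List (Fin n)) :
    listDeriv α l (dilSum S a c ψ) =
      dilSum S (fun k => a k * c k ^ (l.map α).sum) c (listDeriv α l ψ) := by
  induction l generalizing a ψ with
  | nil => simp [listDeriv]
  | cons i l ih =>
    have h' := ih (fun k => a k * c k ^ α i) (h.iterate_partialDeriv i (α i))
    simp only [listDeriv, List.foldl_cons, List.map_cons, List.sum_cons] at h' ⊢
    rw [iterate_partialDeriv_dilSum S a c h, h']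
    simp only [pow_add, mul_assoc]

theorem revGrad_dilSum {ψ : Eucl n → ℝ} (h : IsTest ψ) (m : ℕ) (x : Eucl n) :
    revGrad m (dilSum S a c ψ) x = ∑ k ∈ S, (a k * c k ^ m) • revGrad m ψ (c k • x) := by
  ext α
  have hα : ∑ i, (α : Fin n → ℕ) i = m := by
    have := α.2
    rw [Finset.mem_piAntidiag] at this
    exact this.1
  simp only [revGrad, revDeriv, listDeriv_dilSum S a c h, sum_map_finRange, hα, dilSum]
  simp

end Derivatives

/-! ### Young functions -/

section Young

variable {A : ℝ≥0 → ℝ≥0∞}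

theorem IsYoung.map_mul_le (hA : IsYoung A) {θ : ℝ≥0} (hθ : θ ≤ 1) (t : ℝ≥0) :
    A (θ * t) ≤ θ * A t := by
  have h := hA.convex.2 (Set.mem_univ t) (Set.mem_univ 0) (zero_le : 0 ≤ θ)
    (zero_le : 0 ≤ 1 - θ) (add_tsub_cancel_of_le hθ)
  simpa [hA.map_zero, ENNReal.smul_def] using h

theorem IsYoung.monotone (hA : IsYoung A) : Monotone A := by
  intro a b hab
  rcases eq_or_ne b 0 with rfl | hb
  · rw [nonpos_iff_eq_zero.1 hab]
  · have h1 : a / b ≤ 1 := div_le_one_of_le₀ hab zero_le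
    have h := hA.map_mul_le h1 b
    rw [div_mul_cancel₀ a hb] at h
    exact h.trans (mul_le_of_le_one_left zero_le (by exact_mod_cast h1))

/-- Jensen's inequality for weights of sum at most one. -/
theorem IsYoung.map_sum_le (hA : IsYoung A) {ι : Type*} (S : Finset ι) (θ b : ι → ℝ≥0)
    (hθ : ∑ k ∈ S, θ k ≤ 1) : A (∑ k ∈ S, θ k * b k) ≤ ∑ k ∈ S, θ k * A (b k) := by
  classical
  induction S using Finset.induction_on generalizing θ with
  | empty => simp [hA.map_zero]
  | insert j S hj ih =>
    rw [Finset.sum_insert hj] at hθ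
    rw [Finset.sum_insert hj, Finset.sum_insert hj]
    have hj1 : θ j ≤ 1 := le_self_add.trans hθ
    have hq : ∑ k ∈ S, θ k ≤ 1 - θ j := le_tsub_of_add_le_left hθ
    rcases eq_or_ne (1 - θ j) 0 with h0 | h0
    -- With no mass left the other weights vanish; they could not be renormalised by `1 - θ j`.
    · rw [h0, nonpos_iff_eq_zero, Finset.sum_eq_zero_iff] at hq
      rw [Finset.sum_eq_zero fun k hk => by rw [hq k hk, zero_mul], add_zero]
      exact (hA.map_mul_le hj1 _).trans le_self_add
    · set q := 1 - θ j
      have hs (f : ι → ℝ≥0) : q * ∑ k ∈ S, θ k / q * f k = ∑ k ∈ S, θ k * f k := by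
        rw [Finset.mul_sum]
        exact Finset.sum_congr rfl fun k _ => by field_simp
      have h1 := ih (fun k => θ k / q) (by
        rw [← Finset.sum_div]
        exact div_le_one_of_le₀ hq zero_le)
      have h2 := hA.convex.2 (Set.mem_univ (b j)) (Set.mem_univ (∑ k ∈ S, θ k / q * b k))
        (zero_le : 0 ≤ θ j) (zero_le : 0 ≤ q) (add_tsub_cancel_of_le hj1)
      simp only [smul_eq_mul, hs, ENNReal.smul_def] at h2
      refine h2.trans (add_le_add le_rfl ((mul_le_mul_right h1 _).trans_eq ?_))
      rw [Finset.mul_sum]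
      refine Finset.sum_congr rfl fun k _ => ?_
      rw [← mul_assoc, ← ENNReal.coe_mul, mul_div_cancel₀ _ h0]

/-! ### The discrete inequality and its consequences -/

/-- The discrete form of the embedding into `L¹` of the unit ball. -/
def DiscreteBound (n : ℕ) (s : ℝ) (A : ℝ≥0 → ℝ≥0∞) (C : ℝ≥0) : Prop :=
  ∀ (N : ℕ) (b : ℕ → ℝ≥0), ∑ k ∈ Finset.range N, A (b k) * 2 ^ (k * n) ≤ 1 →
    ∑ k ∈ Finset.range N, b k * ((2 : ℝ≥0) ^ s) ^ k ≤ C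

variable {n : ℕ} {s : ℝ} {C : ℝ≥0}

theorem DiscreteBound.single (h : DiscreteBound n s A C) (hA : IsYoung A) (N : ℕ) (t : ℝ≥0)
    (ht : A t * 2 ^ (N * n) ≤ 1) : t * ((2 : ℝ≥0) ^ s) ^ N ≤ C := by
  have h' := h (N + 1) (fun k => if k = N then t else 0) (by
    rw [Finset.sum_eq_single N]
    · simpa using ht
    · intro k _ hk
      simp [hk, hA.map_zero]
    · simp)
  refine le_trans (le_of_eq ?_) h'
  rw [Finset.sum_eq_single N]
  · simp
  · intro k _ hk
    simp [hk]
  · simp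

/-- By convexity, `t 2^{-Nn} / M` is admissible at scale `N` once `M ≥ A t` and `M ≥ 1`. Hence
`2^{N(s-n)}` stays bounded in `N`, which excludes `s > n`. -/
theorem DiscreteBound.le (h : DiscreteBound n s A C) (hA : IsYoung A) : s ≤ n := by
  by_contra! hs
  obtain ⟨t, ht, hAt⟩ := hA.ne_top
  set M : ℝ≥0 := (A t).toNNReal + 1
  have hM : 1 ≤ M := le_add_self
  have hM0 : M ≠ 0 := (zero_lt_one.trans_le hM).ne'
  have hAM : A t ≤ M := by
    rw [← ENNReal.coe_toNNReal hAt]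
    exact_mod_cast le_self_add
  have key (N : ℕ) : ((2 : ℝ≥0) ^ s / 2 ^ n) ^ N ≤ C * M / t := by
    have h1 : (M * 2 ^ (N * n))⁻¹ ≤ 1 := inv_le_one_of_one_le₀ (one_le_mul hM
      (one_le_pow₀ one_le_two))
    have hne : M * 2 ^ (N * n) ≠ 0 := by positivity
    have h2 := h.single hA N ((M * 2 ^ (N * n))⁻¹ * t) (by
      calc A ((M * 2 ^ (N * n))⁻¹ * t) * 2 ^ (N * n)
          ≤ ((M * 2 ^ (N * n))⁻¹ : ℝ≥0) * M * 2 ^ (N * n) := by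
            gcongr
            exact (hA.map_mul_le h1 t).trans (by gcongr)
        _ = (((M * 2 ^ (N * n))⁻¹ * (M * 2 ^ (N * n)) : ℝ≥0) : ℝ≥0∞) := by
            push_cast
            ring
        _ ≤ 1 := by rw [inv_mul_cancel₀ hne]; simp)
    rw [le_div_iff₀ ht]
    calc ((2 : ℝ≥0) ^ s / 2 ^ n) ^ N * t
        = (M * 2 ^ (N * n))⁻¹ * t * ((2 : ℝ≥0) ^ s) ^ N * M := by
          rw [div_pow, ← pow_mul, mul_comm n N]
          field_simp
      _ ≤ C * M := by gcongr
  have h1 : 1 < (2 : ℝ≥0) ^ s / 2 ^ n := by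
    rw [one_lt_div (by positivity), ← NNReal.rpow_natCast]
    exact NNReal.rpow_lt_rpow_of_exponent_lt one_lt_two hs
  obtain ⟨N, hN⟩ := pow_unbounded_of_one_lt (C * M / t) h1
  exact (key N).not_gt hN

/-- The values at which `A t / t` is at most `(C + 1)⁻¹ 2^{-k(n-s)}`. -/
def lowSet (n : ℕ) (s : ℝ) (A : ℝ≥0 → ℝ≥0∞) (C : ℝ≥0) (k : ℕ) : Set ℝ≥0 :=
  {t | A t ≤ ((C + 1)⁻¹ * (((2 : ℝ≥0) ^ ((n : ℝ) - s)) ^ k)⁻¹ * t : ℝ≥0)}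

theorem two_rpow_mul : (2 : ℝ≥0) ^ s * (2 : ℝ≥0) ^ ((n : ℝ) - s) = 2 ^ n := by
  rw [← NNReal.rpow_add two_ne_zero, add_sub_cancel, NNReal.rpow_natCast]

/-- If the sum `T` exceeded `C + 1`, scaling the `t k` by `θ = (C + 1)/T ≤ 1` would bring it down to
exactly `C + 1`. By convexity and the definition of `lowSet`, the scaled sequence still satisfies
the constraint of `DiscreteBound`, which gives `C + 1 ≤ C`. -/
theorem DiscreteBound.sum_le (h : DiscreteBound n s A C) (hA : IsYoung A) (N : ℕ)
    (t : ℕ → ℝ≥0) (ht : ∀ k, t k ∈ lowSet n s A C k) :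
    ∑ k ∈ Finset.range N, t k * ((2 : ℝ≥0) ^ s) ^ k ≤ C + 1 := by
  by_contra! hT
  set T := ∑ k ∈ Finset.range N, t k * ((2 : ℝ≥0) ^ s) ^ k with hTdef
  have hC : C + 1 ≠ 0 := by positivity
  have hT0 : T ≠ 0 := ((zero_le).trans_lt hT).ne'
  set θ := (C + 1) / T
  have hθ : θ ≤ 1 := div_le_one_of_le₀ hT.le zero_le
  have h1 := h N (fun k => θ * t k) (by
    calc ∑ k ∈ Finset.range N, A (θ * t k) * 2 ^ (k * n)
        ≤ ∑ k ∈ Finset.range N, ((θ * ((C + 1)⁻¹ *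
            (((2 : ℝ≥0) ^ ((n : ℝ) - s)) ^ k)⁻¹ * t k) * 2 ^ (k * n) : ℝ≥0) : ℝ≥0∞) := by
          refine Finset.sum_le_sum fun k _ => ?_
          rw [ENNReal.coe_mul, ENNReal.coe_mul θ, ENNReal.coe_pow, ENNReal.coe_ofNat]
          gcongr
          exact (hA.map_mul_le hθ _).trans (by gcongr; exact ht k)
      _ = ((∑ k ∈ Finset.range N, T⁻¹ * (t k * ((2 : ℝ≥0) ^ s) ^ k) : ℝ≥0) : ℝ≥0∞) := by
          rw [ENNReal.ofNNReal_finsetSum]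
          refine Finset.sum_congr rfl fun k _ => ?_
          congr 1
          rw [mul_comm k n, pow_mul, ← two_rpow_mul (n := n) (s := s), mul_pow]
          have : ((2 : ℝ≥0) ^ ((n : ℝ) - s)) ^ k ≠ 0 := by positivity
          simp only [θ]
          field_simp
      _ ≤ 1 := by
          rw [← Finset.mul_sum, ← hTdef, inv_mul_cancel₀ hT0, ENNReal.coe_one])
  have h2 : ∑ k ∈ Finset.range N, θ * t k * ((2 : ℝ≥0) ^ s) ^ k = C + 1 := by
    simp only [mul_assoc]
    rw [← Finset.mul_sum, ← hTdef, div_mul_cancel₀ _ hT0]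
  rw [h2] at h1
  exact (lt_add_one C).not_ge h1

theorem zero_mem_lowSet (hA : IsYoung A) (k : ℕ) : 0 ∈ lowSet n s A C k := by
  simp [lowSet, hA.map_zero]

theorem DiscreteBound.mul_le (h : DiscreteBound n s A C) (hA : IsYoung A) {k : ℕ} {t : ℝ≥0}
    (ht : t ∈ lowSet n s A C k) : t * ((2 : ℝ≥0) ^ s) ^ k ≤ C + 1 := by
  have h' := h.sum_le hA (k + 1) (fun j => if j = k then t else 0) (fun j => by
    by_cases hj : j = k
    · subst hj; simpa using ht
    · simpa [hj] using zero_mem_lowSet hA j)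
  refine le_trans (le_of_eq ?_) h'
  rw [Finset.sum_eq_single k]
  · simp
  · intro j _ hj
    simp [hj]
  · simp

theorem DiscreteBound.bddAbove (h : DiscreteBound n s A C) (hA : IsYoung A) (k : ℕ) :
    BddAbove (lowSet n s A C k) :=
  ⟨(C + 1) / ((2 : ℝ≥0) ^ s) ^ k, fun _ ht =>
    (le_div_iff₀ (by positivity)).2 (h.mul_le hA ht)⟩

theorem DiscreteBound.sum_sSup_le (h : DiscreteBound n s A C) (hA : IsYoung A) (N : ℕ) :
    ∑ k ∈ Finset.range N, sSup (lowSet n s A C k) * ((2 : ℝ≥0) ^ s) ^ k ≤ 2 * (C + 1) := by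
  -- Approximation within a factor `2` makes it unnecessary to know that the supremum is attained.
  have hex (k : ℕ) : ∃ t ∈ lowSet n s A C k, sSup (lowSet n s A C k) ≤ 2 * t := by
    rcases eq_or_ne (sSup (lowSet n s A C k)) 0 with h0 | h0
    · exact ⟨0, zero_mem_lowSet hA k, by simp [h0]⟩
    · obtain ⟨t, ht, hlt⟩ := exists_lt_of_lt_csSup ⟨0, zero_mem_lowSet hA k⟩
        (NNReal.half_lt_self h0)
      refine ⟨t, ht, ?_⟩
      rw [div_lt_iff₀ two_pos] at hlt
      rw [mul_comm]
      exact hlt.le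
  choose t ht ht' using hex
  calc ∑ k ∈ Finset.range N, sSup (lowSet n s A C k) * ((2 : ℝ≥0) ^ s) ^ k
      ≤ ∑ k ∈ Finset.range N, 2 * t k * ((2 : ℝ≥0) ^ s) ^ k := by
        gcongr with k _
        exact ht' k
    _ = 2 * ∑ k ∈ Finset.range N, t k * ((2 : ℝ≥0) ^ s) ^ k := by
        rw [Finset.mul_sum]
        simp only [mul_assoc]
    _ ≤ 2 * (C + 1) := by
        gcongr
        exact h.sum_le hA N t ht

/-- Let `k` be the first index with `t ∉ lowSet k`. Then `t / A t` is at most `(C + 1) 2^{k(n-s)}`,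
whose power `s/(n-s)` is a constant times `2^{ks}`. If `k = 0` this is the constant term; otherwise
`t` lies in `lowSet (k - 1)`, so the term of index `k - 1` in the series suffices. -/
theorem DiscreteBound.div_rpow_le (h : DiscreteBound n s A C) (hA : IsYoung A) (hs : 0 < s)
    (hsn : s < n) {t : ℝ≥0} (ht : 0 < t) :
    ((t : ℝ≥0∞) / A t) ^ (s / (n - s)) ≤
      ((C + 1) ^ (s / (n - s)) : ℝ≥0) + ∑' k : ℕ,
        (((C + 1) ^ (s / (n - s)) * ((2 : ℝ≥0) ^ s) ^ (k + 1) : ℝ≥0) : ℝ≥0∞) *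
          (Set.Iic (sSup (lowSet n s A C k))).indicator (fun _ => 1) t := by
  have hβ : 0 ≤ s / (n - s) := div_nonneg hs.le (sub_nonneg.2 hsn.le)
  have bound (k : ℕ) (hk : t ∉ lowSet n s A C k) : ((t : ℝ≥0∞) / A t) ^ (s / (n - s)) ≤
      (((C + 1) ^ (s / (n - s)) * ((2 : ℝ≥0) ^ s) ^ k : ℝ≥0) : ℝ≥0∞) := by
    have e : (C + 1) ^ (s / (n - s)) * ((2 : ℝ≥0) ^ s) ^ k =
        ((C + 1) * ((2 : ℝ≥0) ^ ((n : ℝ) - s)) ^ k) ^ (s / (n - s)) := by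
      rw [NNReal.mul_rpow]
      congr 1
      rw [← NNReal.rpow_natCast, ← NNReal.rpow_natCast, ← NNReal.rpow_mul, ← NNReal.rpow_mul,
        ← NNReal.rpow_mul]
      congr 1
      have : (n : ℝ) - s ≠ 0 := (sub_pos.2 hsn).ne'
      field_simp
    rw [e, ENNReal.coe_rpow_of_nonneg _ hβ]
    refine ENNReal.rpow_le_rpow (ENNReal.div_le_of_le_mul ?_) hβ
    have hk' : ((((C + 1)⁻¹ * (((2 : ℝ≥0) ^ ((n : ℝ) - s)) ^ k)⁻¹ * t : ℝ≥0)) : ℝ≥0∞) < A t :=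
      not_le.1 hk
    refine le_trans (le_of_eq ?_) (mul_le_mul_right hk'.le _)
    rw [← ENNReal.coe_mul]
    congr 1
    have h1 : C + 1 ≠ 0 := by positivity
    have h2 : ((2 : ℝ≥0) ^ ((n : ℝ) - s)) ^ k ≠ 0 := by positivity
    field_simp
  -- Otherwise `t 2^{sk} ≤ C + 1` for all `k`, impossible as `s > 0`.
  have hex : ∃ k, t ∉ lowSet n s A C k := by
    by_contra! hall
    obtain ⟨N, hN⟩ := pow_unbounded_of_one_lt ((C + 1) / t)
      (NNReal.one_lt_rpow one_lt_two hs)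
    rw [div_lt_iff₀ ht, mul_comm] at hN
    exact hN.not_ge (h.mul_le hA (hall N))
  classical
  have hmin : ∀ j < Nat.find hex, t ∈ lowSet n s A C j :=
    fun j hj => not_not.1 (Nat.find_min hex hj)
  have hspec := Nat.find_spec hex
  rcases hk : Nat.find hex with _ | j
  · rw [hk] at hspec
    have := bound 0 hspec
    rw [pow_zero, mul_one] at this
    exact this.trans le_self_add
  · rw [hk] at hspec
    have hj := hmin j (by omega)
    refine ((bound _ hspec).trans ?_).trans le_add_self
    refine le_trans (le_of_eq ?_) (ENNReal.le_tsum j)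
    rw [Set.indicator_of_mem, mul_one]
    exact le_csSup (h.bddAbove hA j) hj

theorem DiscreteBound.lintegral_lt_top (h : DiscreteBound n s A C) (hA : IsYoung A)
    (hs : 0 < s) (hsn : s < n) :
    ∫⁻ t in Set.Ioc 0 (1 : ℝ), (ENNReal.ofReal t / A t.toNNReal) ^ (s / (n - s)) < ∞ := by
  set τ := fun k => sSup (lowSet n s A C k)
  set K : ℝ≥0 := (C + 1) ^ (s / (n - s))
  set q : ℝ≥0 := (2 : ℝ≥0) ^ s
  calc ∫⁻ t in Set.Ioc 0 (1 : ℝ), (ENNReal.ofReal t / A t.toNNReal) ^ (s / (n - s))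
      ≤ ∫⁻ t in Set.Ioc 0 (1 : ℝ), ((K : ℝ≥0∞) + ∑' k : ℕ, ((K * q ^ (k + 1) : ℝ≥0) : ℝ≥0∞) *
          (Set.Iic (τ k : ℝ)).indicator (fun _ => 1) t) := by
        refine setLIntegral_mono' measurableSet_Ioc fun t ht => ?_
        refine (h.div_rpow_le hA hs hsn (Real.toNNReal_pos.2 ht.1)).trans_eq ?_
        congr 1
        refine tsum_congr fun k => ?_
        congr 1
        simp only [Set.indicator, Set.mem_Iic, Real.toNNReal_le_iff_le_coe, τ]
    _ ≤ K + ∑' k : ℕ, ((K * q ^ (k + 1) : ℝ≥0) : ℝ≥0∞) * τ k := by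
        rw [lintegral_add_left measurable_const, lintegral_tsum fun k =>
          ((measurable_const.indicator measurableSet_Iic).const_mul _).aemeasurable]
        gcongr with k
        · simp
        · rw [lintegral_const_mul _ (measurable_const.indicator measurableSet_Iic),
            lintegral_indicator measurableSet_Iic, Measure.restrict_restrict measurableSet_Iic]
          gcongr
          rw [lintegral_one, Measure.restrict_apply_univ]
          calc volume (Set.Iic (τ k : ℝ) ∩ Set.Ioc 0 1) ≤ volume (Set.Ioc 0 (τ k : ℝ)) :=
                measure_mono fun x hx => ⟨hx.2.1, hx.1⟩
            _ = τ k := by simp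
    _ ≤ K + ((K * q * (2 * (C + 1)) : ℝ≥0) : ℝ≥0∞) := by
        gcongr
        rw [ENNReal.tsum_eq_iSup_nat]
        refine iSup_le fun N => ?_
        have h1 := h.sum_sSup_le hA N
        calc ∑ k ∈ Finset.range N, ((K * q ^ (k + 1) : ℝ≥0) : ℝ≥0∞) * τ k
            = ((K * q * ∑ k ∈ Finset.range N, τ k * q ^ k : ℝ≥0) : ℝ≥0∞) := by
              rw [Finset.mul_sum, ENNReal.ofNNReal_finsetSum]
              refine Finset.sum_congr rfl fun k _ => ?_
              rw [← ENNReal.coe_mul]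
              congr 1
              ring
          _ ≤ _ := by
              rw [ENNReal.coe_le_coe]
              gcongr
    _ < ∞ := by
        rw [← ENNReal.coe_add]
        exact ENNReal.coe_lt_top

end Young

/-! ### The fractional difference quotient -/

section Quotient

/-- `min(r^{1-σ}, r^{-σ})`, which bounds difference quotients of order `σ` of bounded Lipschitz
functions. -/
noncomputable def minPow (σ r : ℝ) : ℝ := min (r ^ (1 - σ)) (r ^ (-σ))

theorem minPow_nonneg {σ r : ℝ} (hr : 0 ≤ r) : 0 ≤ minPow σ r :=
  le_min (Real.rpow_nonneg hr _) (Real.rpow_nonneg hr _)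

theorem summable_pow_natAbs {ρ : ℝ} (h0 : 0 ≤ ρ) (h1 : ρ < 1) :
    Summable fun i : ℤ => ρ ^ i.natAbs := by
  have h := summable_geometric_of_lt_one h0 h1
  exact Summable.of_nat_of_neg (by simpa using h) (by simpa using h)

/-- The factor `2` is needed for `i < 0`, where `x` is compared with `2^{i+1}` instead of `2^i`. -/
theorem minPow_le {σ x : ℝ} (h0 : 0 < σ) (h1 : σ < 1) (i : ℤ) (hx : (2 : ℝ) ^ i ≤ x)
    (hx' : x < (2 : ℝ) ^ (i + 1)) :
    minPow σ x ≤ 2 * ((2 : ℝ) ^ (-min σ (1 - σ))) ^ i.natAbs := by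
  have hxpos : 0 < x := (zpow_pos two_pos i).trans_le hx
  rw [← Real.rpow_natCast, ← Real.rpow_mul two_pos.le]
  rcases le_or_gt 0 i with hi | hi
  · have hcast : (i.natAbs : ℝ) = (i : ℝ) := by
      rw [← Int.cast_natCast, Int.natAbs_of_nonneg hi]
    have hi' : (0 : ℝ) ≤ i := by exact_mod_cast hi
    calc minPow σ x ≤ x ^ (-σ) := min_le_right _ _
      _ ≤ ((2 : ℝ) ^ i) ^ (-σ) :=
        Real.rpow_le_rpow_of_nonpos (zpow_pos two_pos i) hx (by linarith)
      _ = (2 : ℝ) ^ (-(i * σ)) := by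
        rw [← Real.rpow_intCast, ← Real.rpow_mul two_pos.le]
        ring_nf
      _ ≤ (2 : ℝ) ^ (-min σ (1 - σ) * (i.natAbs : ℝ)) := by
        refine Real.rpow_le_rpow_of_exponent_le one_le_two ?_
        rw [hcast]
        nlinarith [min_le_left σ (1 - σ)]
      _ ≤ _ := by linarith [Real.rpow_pos_of_pos two_pos (-min σ (1 - σ) * (i.natAbs : ℝ))]
  · have hcast : (i.natAbs : ℝ) = -(i : ℝ) := by
      rw [← Int.cast_natCast, Int.ofNat_natAbs_of_nonpos hi.le, Int.cast_neg]
    have hi' : (i : ℝ) < 0 := by exact_mod_cast hi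
    calc minPow σ x ≤ x ^ (1 - σ) := min_le_left _ _
      _ ≤ ((2 : ℝ) ^ (i + 1)) ^ (1 - σ) :=
        Real.rpow_le_rpow hxpos.le hx'.le (by linarith)
      _ = (2 : ℝ) ^ (((i : ℝ) + 1) * (1 - σ)) := by
        rw [← Real.rpow_intCast, ← Real.rpow_mul two_pos.le]
        push_cast
        rfl
      _ ≤ (2 : ℝ) ^ (1 + -min σ (1 - σ) * (i.natAbs : ℝ)) := by
        refine Real.rpow_le_rpow_of_exponent_le one_le_two ?_
        rw [hcast]
        nlinarith [min_le_right σ (1 - σ)]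
      _ = _ := by rw [Real.rpow_add two_pos, Real.rpow_one]

/-- The numbers `2^{-k} r` lie in distinct dyadic intervals, so the sum is dominated by a two-sided
geometric series that does not depend on `r`. -/
theorem exists_sum_minPow_le {σ : ℝ} (h0 : 0 < σ) (h1 : σ < 1) :
    ∃ S : ℝ, ∀ r : ℝ, 0 < r → ∀ N : ℕ,
      ∑ k ∈ Finset.range N, minPow σ (((2 : ℝ) ^ k)⁻¹ * r) ≤ S := by
  set ρ : ℝ := (2 : ℝ) ^ (-min σ (1 - σ))
  have hρ0 : 0 ≤ ρ := by positivity
  have hρ1 : ρ < 1 :=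
    Real.rpow_lt_one_of_one_lt_of_neg one_lt_two (neg_lt_zero.2 (lt_min h0 (by linarith)))
  have hsum := summable_pow_natAbs hρ0 hρ1
  refine ⟨2 * ∑' i : ℤ, ρ ^ i.natAbs, fun r hr N => ?_⟩
  obtain ⟨j, hj, hj'⟩ := exists_mem_Ico_zpow hr one_lt_two
  have hterm (k : ℕ) : minPow σ (((2 : ℝ) ^ k)⁻¹ * r) ≤ 2 * ρ ^ (j - k).natAbs := by
    refine minPow_le h0 h1 _ ?_ ?_
    · rw [zpow_sub₀ two_ne_zero, zpow_natCast, div_eq_inv_mul]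
      gcongr
    · rw [show j - k + 1 = j + 1 - k by ring, zpow_sub₀ two_ne_zero, zpow_natCast,
        div_eq_inv_mul]
      gcongr
  have hinj : Function.Injective fun k : ℕ => j - (k : ℤ) := fun a b hab => by
    have : j - (a : ℤ) = j - b := hab
    omega
  calc ∑ k ∈ Finset.range N, minPow σ (((2 : ℝ) ^ k)⁻¹ * r)
      ≤ ∑ k ∈ Finset.range N, 2 * ρ ^ (j - k).natAbs := Finset.sum_le_sum fun k _ => hterm k
    _ = 2 * ∑ i ∈ (Finset.range N).map ⟨_, hinj⟩, ρ ^ i.natAbs := by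
      rw [Finset.sum_map, Finset.mul_sum]
      rfl
    _ ≤ 2 * ∑' i : ℤ, ρ ^ i.natAbs := by
      gcongr
      exact hsum.sum_le_tsum _ fun i _ => by positivity

/-! ### Difference quotients of bounded Lipschitz maps -/

variable {n : ℕ} {F : Type*} [NormedAddCommGroup F]

/-- The difference quotient `|Φ(x) - Φ(y)| / |x - y|^σ`. -/
noncomputable def diffQuot (σ : ℝ) (Φ : Eucl n → F) (x y : Eucl n) : ℝ≥0 :=
  ‖Φ x - Φ y‖₊ / ‖x - y‖₊ ^ σ

theorem diffQuot_self (σ : ℝ) (Φ : Eucl n → F) (x : Eucl n) : diffQuot σ Φ x x = 0 := by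
  simp [diffQuot]

/-- Bounded Lipschitz functions with bounded support. -/
structure IsBumpLike (Φ : Eucl n → F) (L R : ℝ) : Prop where
  lipschitz : ∀ x y, ‖Φ x - Φ y‖ ≤ L * ‖x - y‖
  bounded : ∀ x y, ‖Φ x - Φ y‖ ≤ L
  support : ∀ x, R ≤ ‖x‖ → Φ x = 0

theorem exists_isBumpLike [NormedSpace ℝ F] {Φ : Eucl n → F} (hΦ : ContDiff ℝ 1 Φ)
    (h : ∃ R : ℝ, ∀ x, R ≤ ‖x‖ → Φ x = 0) : ∃ L R : ℝ, IsBumpLike Φ L R := by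
  obtain ⟨R, hR⟩ := h
  have hc : HasCompactSupport Φ := by
    refine HasCompactSupport.intro (isCompact_closedBall (0 : Eucl n) R) fun x hx => hR x ?_
    rw [mem_closedBall_zero_iff] at hx
    exact (not_le.1 hx).le
  obtain ⟨K, hK⟩ := hΦ.lipschitzWith_of_hasCompactSupport hc one_ne_zero
  obtain ⟨M, hM⟩ := hΦ.continuous.bounded_above_of_compact_support hc
  refine ⟨max K (M + M), R, fun x y => ?_, fun x y => ?_, hR⟩
  · refine (hK.norm_sub_le x y).trans ?_
    gcongr
    exact le_max_left _ _
  · exact ((norm_sub_le _ _).trans (add_le_add (hM x) (hM y))).trans (le_max_right _ _)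

theorem IsBumpLike.nonneg {Φ : Eucl n → F} {L R : ℝ} (h : IsBumpLike Φ L R) : 0 ≤ L :=
  (norm_nonneg _).trans (h.bounded 0 0)

theorem IsBumpLike.continuous {Φ : Eucl n → F} {L R : ℝ} (h : IsBumpLike Φ L R) :
    Continuous Φ :=
  (LipschitzWith.of_dist_le_mul (K := L.toNNReal) fun x y => by
    rw [dist_eq_norm, dist_eq_norm, Real.coe_toNNReal _ h.nonneg]
    exact h.lipschitz x y).continuous

theorem IsBumpLike.diffQuot_le {Φ : Eucl n → F} {L R σ : ℝ} (h : IsBumpLike Φ L R)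
    {x y : Eucl n} (hxy : x ≠ y) : (diffQuot σ Φ x y : ℝ) ≤ L * minPow σ ‖x - y‖ := by
  have hpos : 0 < ‖x - y‖ := norm_pos_iff.2 (sub_ne_zero.2 hxy)
  have hp := Real.rpow_pos_of_pos hpos σ
  rw [diffQuot, NNReal.coe_div, NNReal.coe_rpow, coe_nnnorm, coe_nnnorm, minPow,
    mul_min_of_nonneg _ _ h.nonneg]
  refine le_min ?_ ?_
  · rw [Real.rpow_sub hpos, Real.rpow_one, ← mul_div_assoc]
    gcongr
    exact h.lipschitz x y
  · rw [Real.rpow_neg hpos.le, ← div_eq_mul_inv]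
    gcongr
    exact h.bounded x y

theorem IsBumpLike.exists_sum_diffQuot_le {Φ : Eucl n → F} {L R σ : ℝ}
    (h : IsBumpLike Φ L R) (h0 : 0 < σ) (h1 : σ < 1) :
    ∃ S : ℝ≥0, ∀ (x y : Eucl n) (N : ℕ),
      ∑ k ∈ Finset.range N, diffQuot σ Φ (((2 : ℝ) ^ k)⁻¹ • x) (((2 : ℝ) ^ k)⁻¹ • y) ≤ S := by
  obtain ⟨S, hS⟩ := exists_sum_minPow_le h0 h1
  refine ⟨(L * S).toNNReal, fun x y N => ?_⟩
  rcases eq_or_ne x y with rfl | hxy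
  · simp [diffQuot_self]
  · have hpos : 0 < ‖x - y‖ := norm_pos_iff.2 (sub_ne_zero.2 hxy)
    refine NNReal.le_toNNReal_of_coe_le ?_
    rw [NNReal.coe_sum]
    refine le_trans ?_ (mul_le_mul_of_nonneg_left (hS _ hpos N) h.nonneg)
    rw [Finset.mul_sum]
    refine Finset.sum_le_sum fun k _ => ?_
    have hk : ((2 : ℝ) ^ k)⁻¹ ≠ 0 := by positivity
    refine (h.diffQuot_le ((smul_right_injective _ hk).ne hxy)).trans_eq ?_
    rw [← smul_sub, norm_smul, Real.norm_of_nonneg (by positivity)]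

/-! ### The fractional Sobolev seminorm with exponent one -/

/-- In polar coordinates the integrand becomes `minPow σ r / r`, integrable at `0` because `σ < 1`
and at infinity because `σ > 0`. -/
theorem lintegral_minPow_lt_top (hn : 0 < n) {σ : ℝ} (h0 : 0 < σ) (h1 : σ < 1) :
    ∫⁻ z : Eucl n, ENNReal.ofReal (minPow σ ‖z‖ / ‖z‖ ^ n) < ∞ := by
  have : Nonempty (Fin n) := ⟨⟨0, hn⟩⟩
  have hint : Integrable (fun z : Eucl n => minPow σ ‖z‖ / ‖z‖ ^ n) volume := by
    refine (integrable_fun_norm_addHaar volume (f := fun r => minPow σ r / r ^ n)).2 ?_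
    rw [finrank_euclideanSpace_fin]
    have hmeas : Measurable fun r : ℝ => r ^ (n - 1) • (minPow σ r / r ^ n) := by
      unfold minPow
      fun_prop
    have heq {r : ℝ} (hr : 0 < r) : r ^ (n - 1) • (minPow σ r / r ^ n) = minPow σ r / r := by
      obtain ⟨m, rfl⟩ : ∃ m, n = m + 1 := ⟨n - 1, by omega⟩
      rw [add_tsub_cancel_right, smul_eq_mul, pow_succ]
      field_simp
    rw [← Set.Ioc_union_Ioi_eq_Ioi zero_le_one]
    refine IntegrableOn.union ?_ ?_
    · have hI : IntegrableOn (fun r : ℝ => r ^ (-σ)) (Set.Ioc 0 1) :=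
        (intervalIntegrable_iff_integrableOn_Ioc_of_le zero_le_one).1
          (intervalIntegral.intervalIntegrable_rpow' (by linarith))
      refine hI.mono' hmeas.aestronglyMeasurable ?_
      refine (ae_restrict_mem measurableSet_Ioc).mono fun r hr => ?_
      rw [heq hr.1, Real.norm_of_nonneg (div_nonneg (minPow_nonneg hr.1.le) hr.1.le),
        div_le_iff₀ hr.1]
      refine (min_le_left _ _).trans_eq ?_
      rw [show 1 - σ = -σ + 1 by ring, Real.rpow_add_one hr.1.ne']
    · have hI : IntegrableOn (fun r : ℝ => r ^ (-σ - 1)) (Set.Ioi 1) :=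
        integrableOn_Ioi_rpow_of_lt (by linarith) one_pos
      refine hI.mono' hmeas.aestronglyMeasurable ?_
      refine (ae_restrict_mem measurableSet_Ioi).mono fun r hr => ?_
      have hr0 : 0 < r := one_pos.trans hr
      rw [heq hr0, Real.norm_of_nonneg (div_nonneg (minPow_nonneg hr0.le) hr0.le),
        Real.rpow_sub_one hr0.ne']
      gcongr
      exact min_le_right _ _
  exact hint.lintegral_lt_top

theorem lintegral_lintegral_add_mul_sub {χ g : Eucl n → ℝ≥0∞} (hχ : Measurable χ)
    (hg : Measurable g) :
    ∫⁻ x, ∫⁻ y, (χ x * g (x - y) + χ y * g (x - y)) = 2 * ((∫⁻ x, χ x) * ∫⁻ z, g z) := by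
  have hm1 : Measurable (Function.uncurry fun x y : Eucl n => χ x * g (x - y)) :=
    (hχ.comp measurable_fst).mul (hg.comp (measurable_fst.sub measurable_snd))
  have hm2 : Measurable (Function.uncurry fun x y : Eucl n => χ y * g (x - y)) :=
    (hχ.comp measurable_snd).mul (hg.comp (measurable_fst.sub measurable_snd))
  have hI1 : ∫⁻ x, ∫⁻ y, χ x * g (x - y) = (∫⁻ x, χ x) * ∫⁻ z, g z := by
    rw [← lintegral_mul_const _ hχ]
    refine lintegral_congr fun x => ?_
    have hm : Measurable fun y => g (x - y) := hg.comp (measurable_const.sub measurable_id)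
    rw [lintegral_const_mul _ hm, lintegral_sub_left_eq_self g x]
  have hI2 : ∫⁻ x, ∫⁻ y, χ y * g (x - y) = (∫⁻ x, χ x) * ∫⁻ z, g z := by
    rw [lintegral_lintegral_swap hm2.aemeasurable, ← lintegral_mul_const _ hχ]
    refine lintegral_congr fun y => ?_
    have hm : Measurable fun x => g (x - y) := hg.comp (measurable_id.sub measurable_const)
    rw [lintegral_const_mul _ hm, lintegral_sub_right_eq_self g y]
  have h (x : Eucl n) : ∫⁻ y, (χ x * g (x - y) + χ y * g (x - y)) =
      (∫⁻ y, χ x * g (x - y)) + ∫⁻ y, χ y * g (x - y) :=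
    lintegral_add_left hm1.of_uncurry_left _
  simp_rw [h]
  rw [lintegral_add_left hm1.lintegral_prod_right, hI1, hI2, two_mul]

/-- The integral `∫∫ |Φ(x) - Φ(y)| / |x - y|^{n+σ} dx dy`. -/
noncomputable def gagliardo (σ : ℝ) (Φ : Eucl n → F) : ℝ≥0∞ :=
  ∫⁻ x, ∫⁻ y, (diffQuot σ Φ x y : ℝ≥0∞) / ‖x - y‖ₑ ^ n

/-- The integrand vanishes unless `x` or `y` lies in the ball `B`, so it is dominated by a multiple
of `(χ x + χ y) g(x - y)` with `χ` and `g` integrable. -/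
theorem IsBumpLike.gagliardo_lt_top {Φ : Eucl n → F} {L R σ : ℝ} (h : IsBumpLike Φ L R)
    (hn : 0 < n) (h0 : 0 < σ) (h1 : σ < 1) : gagliardo σ Φ < ∞ := by
  set g : Eucl n → ℝ≥0∞ := fun z => ENNReal.ofReal (minPow σ ‖z‖ / ‖z‖ ^ n)
  set B : Set (Eucl n) := Metric.ball 0 R
  set χ : Eucl n → ℝ≥0∞ := B.indicator fun _ => 1
  have hg : Measurable g := by
    unfold g minPow
    fun_prop
  have hχ : Measurable χ := measurable_const.indicator measurableSet_ball
  have hχB : ∫⁻ x, χ x = volume B := by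
    exact lintegral_indicator_one measurableSet_ball
  have hpt (x y : Eucl n) : (diffQuot σ Φ x y : ℝ≥0∞) / ‖x - y‖ₑ ^ n ≤
      ENNReal.ofReal L * (χ x * g (x - y) + χ y * g (x - y)) := by
    rcases eq_or_ne x y with rfl | hxy
    · simp [diffQuot_self]
    by_cases hB : x ∉ B ∧ y ∉ B
    · have hz {z : Eucl n} (hz : z ∉ B) : Φ z = 0 :=
        h.support z (not_lt.1 fun hlt => hz (mem_ball_zero_iff.2 hlt))
      simp [diffQuot, hz hB.1, hz hB.2]
    · have hχ1 : 1 ≤ χ x + χ y := by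
        by_cases hx : x ∈ B
        · exact le_add_right (by simp [χ, hx])
        · have hy : y ∈ B := by tauto
          exact le_add_left (by simp [χ, hy])
      have hpos : 0 < ‖x - y‖ := norm_pos_iff.2 (sub_ne_zero.2 hxy)
      calc (diffQuot σ Φ x y : ℝ≥0∞) / ‖x - y‖ₑ ^ n
          = ENNReal.ofReal (diffQuot σ Φ x y / ‖x - y‖ ^ n) := by
            rw [ENNReal.ofReal_div_of_pos (by positivity), ENNReal.ofReal_coe_nnreal,
              ENNReal.ofReal_pow hpos.le, ofReal_norm]
        _ ≤ ENNReal.ofReal (L * (minPow σ ‖x - y‖ / ‖x - y‖ ^ n)) := by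
            refine ENNReal.ofReal_le_ofReal ?_
            rw [← mul_div_assoc]
            gcongr
            exact h.diffQuot_le hxy
        _ = ENNReal.ofReal L * (1 * g (x - y)) := by
            rw [ENNReal.ofReal_mul h.nonneg, one_mul]
        _ ≤ _ := by
            rw [← add_mul]
            gcongr
  have hG : ∫⁻ z, g z < ∞ := lintegral_minPow_lt_top hn h0 h1
  refine (lintegral_mono fun x => lintegral_mono fun y => hpt x y).trans_lt ?_
  simp_rw [lintegral_const_mul' _ _ ENNReal.ofReal_ne_top]
  rw [lintegral_lintegral_add_mul_sub hχ hg, hχB]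
  exact ENNReal.mul_lt_top ENNReal.ofReal_lt_top
    (ENNReal.mul_lt_top (by simp) (ENNReal.mul_lt_top measure_ball_lt_top hG))

theorem measurable_diffQuot_div (σ : ℝ) {Φ : Eucl n → F} (hΦ : Continuous Φ) (c : ℝ) :
    Measurable (Function.uncurry fun x y : Eucl n =>
      (diffQuot σ Φ (c • x) (c • y) : ℝ≥0∞) / ‖x - y‖ₑ ^ n) := by
  have h1 : Measurable fun p : Eucl n × Eucl n => ‖Φ (c • p.1) - Φ (c • p.2)‖₊ :=
    Continuous.measurable (by fun_prop)
  have h2 : Measurable fun p : Eucl n × Eucl n => ‖c • p.1 - c • p.2‖₊ :=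
    Continuous.measurable (by fun_prop)
  have h3 : Measurable fun p : Eucl n × Eucl n => ‖p.1 - p.2‖ₑ ^ n := by fun_prop
  exact (h1.div (h2.pow_const σ)).coe_nnreal_ennreal.div h3

/-! ### Scaling of the double integral -/

theorem lintegral_comp_smul (f : Eucl n → ℝ≥0∞) {c : ℝ} (hc : 0 < c) :
    ∫⁻ x, f (c • x) = ENNReal.ofReal (c⁻¹ ^ n) * ∫⁻ x, f x := by
  have h := (MeasurableEquiv.smul₀ c hc.ne' : Eucl n ≃ᵐ Eucl n).measurableEmbedding.lintegral_map
    (μ := volume) f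
  have h2 := Measure.map_addHaar_smul (volume : Measure (Eucl n)) hc.ne'
  rw [finrank_euclideanSpace_fin, abs_of_pos (by positivity), ← inv_pow] at h2
  change ∫⁻ x, f x ∂(Measure.map (c • ·) volume) = ∫⁻ x, f (c • x) at h
  rw [← h, h2, lintegral_smul_measure, smul_eq_mul]

/-- The two changes of variables produce `2^{2kn}`, and the kernel `|x - y|^{-n}` gives back
`2^{-kn}`. -/
theorem lintegral_diffQuot_smul (σ : ℝ) (Φ : Eucl n → F) (k : ℕ) :
    ∫⁻ x, ∫⁻ y, (diffQuot σ Φ (((2 : ℝ) ^ k)⁻¹ • x) (((2 : ℝ) ^ k)⁻¹ • y) : ℝ≥0∞) /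
      ‖x - y‖ₑ ^ n = 2 ^ (k * n) * gagliardo σ Φ := by
  set c : ℝ := ((2 : ℝ) ^ k)⁻¹
  have hc : 0 < c := by positivity
  have hcn : ENNReal.ofReal (c⁻¹ ^ n) = 2 ^ (k * n) := by
    rw [inv_inv, ← pow_mul, ENNReal.ofReal_pow two_pos.le, ENNReal.ofReal_ofNat]
  have hce : ‖c‖ₑ ^ n * 2 ^ (k * n) = 1 := by
    rw [← hcn, ← ofReal_norm, Real.norm_of_nonneg hc.le, ← ENNReal.ofReal_pow hc.le,
      ← ENNReal.ofReal_mul (by positivity), ← mul_pow, mul_inv_cancel₀ hc.ne', one_pow,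
      ENNReal.ofReal_one]
  have hne0 : (2 : ℝ≥0∞) ^ (k * n) ≠ 0 := pow_ne_zero _ two_ne_zero
  have hnet : (2 : ℝ≥0∞) ^ (k * n) ≠ ∞ := ENNReal.pow_ne_top ENNReal.ofNat_ne_top
  have hpt (x y : Eucl n) : (diffQuot σ Φ (c • x) (c • y) : ℝ≥0∞) / ‖x - y‖ₑ ^ n =
      (2 ^ (k * n))⁻¹ * ((diffQuot σ Φ (c • x) (c • y) : ℝ≥0∞) / ‖c • x - c • y‖ₑ ^ n) := by
    have hcinv : (‖c‖ₑ ^ n)⁻¹ = 2 ^ (k * n) := (ENNReal.eq_inv_of_mul_eq_one_left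
      (by rwa [mul_comm])).symm
    rw [← smul_sub, enorm_smul, mul_pow, ENNReal.div_eq_inv_mul, ENNReal.div_eq_inv_mul,
      ENNReal.mul_inv (Or.inr (by finiteness)) (Or.inl (by finiteness)), hcinv, ← mul_assoc,
      ← mul_assoc, ENNReal.inv_mul_cancel hne0 hnet, one_mul]
  simp only [hpt]
  simp_rw [lintegral_const_mul' _ _ (ENNReal.inv_ne_top.2 hne0)]
  have hin (x : Eucl n) :
      ∫⁻ y, (diffQuot σ Φ (c • x) (c • y) : ℝ≥0∞) / ‖c • x - c • y‖ₑ ^ n =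
        2 ^ (k * n) * ∫⁻ y, (diffQuot σ Φ (c • x) y : ℝ≥0∞) / ‖c • x - y‖ₑ ^ n := by
    rw [lintegral_comp_smul (fun y => (diffQuot σ Φ (c • x) y : ℝ≥0∞) / ‖c • x - y‖ₑ ^ n) hc, hcn]
  simp_rw [hin]
  rw [lintegral_const_mul' _ _ hnet, ← mul_assoc, ENNReal.inv_mul_cancel hne0 hnet, one_mul,
    lintegral_comp_smul (fun x => ∫⁻ y, (diffQuot σ Φ x y : ℝ≥0∞) / ‖x - y‖ₑ ^ n) hc, hcn]
  rfl

end Quotient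

/-! ### The modular of superpositions of dilations -/

section Modular

variable {n : ℕ} {F : Type*} [NormedAddCommGroup F] {A : ℝ≥0 → ℝ≥0∞}

theorem fracModular_congr {σ : ℝ} {w v : Eucl n → F} (h : w =ᵐ[volume] v) :
    fracModular σ A w = fracModular σ A v := by
  refine lintegral_congr_ae (h.mono fun x hx => lintegral_congr_ae (h.mono fun y hy => ?_))
  simp only [hx, hy]

theorem lintegral_lintegral_sum_const_mul {ι : Type*} (S : Finset ι) (a : ι → ℝ≥0∞)
    {f : ι → Eucl n → Eucl n → ℝ≥0∞} (hf : ∀ k, Measurable (Function.uncurry (f k))) :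
    ∫⁻ x, ∫⁻ y, ∑ k ∈ S, a k * f k x y = ∑ k ∈ S, a k * ∫⁻ x, ∫⁻ y, f k x y := by
  have h (x : Eucl n) : ∫⁻ y, ∑ k ∈ S, a k * f k x y = ∑ k ∈ S, a k * ∫⁻ y, f k x y := by
    rw [lintegral_finsetSum _ fun k _ => (hf k).of_uncurry_left.const_mul (a k)]
    exact Finset.sum_congr rfl fun k _ => lintegral_const_mul _ (hf k).of_uncurry_left
  simp_rw [h]
  rw [lintegral_finsetSum _ fun k _ => (hf k).lintegral_prod_right.const_mul (a k)]
  exact Finset.sum_congr rfl fun k _ => lintegral_const_mul _ (hf k).lintegral_prod_right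

variable [NormedSpace ℝ F]

/-- The factor `2^{kσ}` is exactly what the dilation by `2^{-k}` takes from a difference quotient of
order `σ`. -/
theorem nnnorm_sum_div_le (σ : ℝ) (Φ : Eucl n → F) (N : ℕ) (b : ℕ → ℝ≥0) (l : ℝ≥0)
    (x y : Eucl n) :
    ‖(l : ℝ)⁻¹ • (∑ k ∈ Finset.range N,
          ((b k : ℝ) * ((2 : ℝ) ^ k) ^ σ) • Φ (((2 : ℝ) ^ k)⁻¹ • x)) -
        (l : ℝ)⁻¹ • ∑ k ∈ Finset.range N,
          ((b k : ℝ) * ((2 : ℝ) ^ k) ^ σ) • Φ (((2 : ℝ) ^ k)⁻¹ • y)‖₊ / ‖x - y‖₊ ^ σ ≤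
      ∑ k ∈ Finset.range N,
        diffQuot σ Φ (((2 : ℝ) ^ k)⁻¹ • x) (((2 : ℝ) ^ k)⁻¹ • y) / l * b k := by
  rw [← smul_sub, ← Finset.sum_sub_distrib, nnnorm_smul]
  simp only [← smul_sub]
  have h1 : ‖(l : ℝ)⁻¹‖₊ = l⁻¹ := by simp
  rw [h1]
  calc l⁻¹ * ‖∑ k ∈ Finset.range N, ((b k : ℝ) * ((2 : ℝ) ^ k) ^ σ) •
          (Φ (((2 : ℝ) ^ k)⁻¹ • x) - Φ (((2 : ℝ) ^ k)⁻¹ • y))‖₊ / ‖x - y‖₊ ^ σ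
      ≤ l⁻¹ * (∑ k ∈ Finset.range N, ‖((b k : ℝ) * ((2 : ℝ) ^ k) ^ σ) •
          (Φ (((2 : ℝ) ^ k)⁻¹ • x) - Φ (((2 : ℝ) ^ k)⁻¹ • y))‖₊) / ‖x - y‖₊ ^ σ := by
        gcongr
        exact nnnorm_sum_le _ _
    _ = _ := by
        rw [Finset.mul_sum, Finset.sum_div]
        refine Finset.sum_congr rfl fun k _ => ?_
        have h2 : ‖(b k : ℝ) * ((2 : ℝ) ^ k) ^ σ‖₊ = b k * ((2 : ℝ≥0) ^ k) ^ σ := by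
          ext
          rw [coe_nnnorm, Real.norm_of_nonneg (by positivity)]
          simp
        have h3 : ‖((2 : ℝ) ^ k)⁻¹‖₊ = ((2 : ℝ≥0) ^ k)⁻¹ := by
          ext
          rw [coe_nnnorm, Real.norm_of_nonneg (by positivity)]
          simp
        rw [nnnorm_smul, h2, diffQuot, ← smul_sub, nnnorm_smul, h3, NNReal.mul_rpow,
          NNReal.inv_rpow]
        simp only [div_eq_mul_inv, mul_inv, inv_inv]
        ring

/-- Jensen's inequality is applied pointwise with weights `G k x y / l`, of sum at most one since `S
≤ l`. The weights are then integrated, and `gagliardo σ Φ ≤ l` cancels the remaining `1 / l`. -/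
theorem fracModular_sum_le_one (hA : IsYoung A) {σ : ℝ} {Φ : Eucl n → F} (hΦ : Continuous Φ)
    {S l : ℝ≥0} (hS : ∀ (x y : Eucl n) (N : ℕ),
      ∑ k ∈ Finset.range N, diffQuot σ Φ (((2 : ℝ) ^ k)⁻¹ • x) (((2 : ℝ) ^ k)⁻¹ • y) ≤ S)
    (hl : 0 < l) (hSl : S ≤ l) (hKl : gagliardo σ Φ ≤ l) (N : ℕ) (b : ℕ → ℝ≥0)
    (hb : ∑ k ∈ Finset.range N, A (b k) * 2 ^ (k * n) ≤ 1) :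
    fracModular σ A (fun x => (l : ℝ)⁻¹ • ∑ k ∈ Finset.range N,
      ((b k : ℝ) * ((2 : ℝ) ^ k) ^ σ) • Φ (((2 : ℝ) ^ k)⁻¹ • x)) ≤ 1 := by
  set G : ℕ → Eucl n → Eucl n → ℝ≥0 := fun k x y =>
    diffQuot σ Φ (((2 : ℝ) ^ k)⁻¹ • x) (((2 : ℝ) ^ k)⁻¹ • y)
  have hl0 : (l : ℝ≥0∞) ≠ 0 := by exact_mod_cast hl.ne'
  have hpt (x y : Eucl n) :
      A (‖(l : ℝ)⁻¹ • (∑ k ∈ Finset.range N,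
          ((b k : ℝ) * ((2 : ℝ) ^ k) ^ σ) • Φ (((2 : ℝ) ^ k)⁻¹ • x)) -
        (l : ℝ)⁻¹ • ∑ k ∈ Finset.range N,
          ((b k : ℝ) * ((2 : ℝ) ^ k) ^ σ) • Φ (((2 : ℝ) ^ k)⁻¹ • y)‖₊ / ‖x - y‖₊ ^ σ) /
        ‖x - y‖ₑ ^ n ≤
      ∑ k ∈ Finset.range N, A (b k) / l * ((G k x y : ℝ≥0∞) / ‖x - y‖ₑ ^ n) := by
    calc _ ≤ (∑ k ∈ Finset.range N, ((G k x y / l : ℝ≥0) : ℝ≥0∞) * A (b k)) /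
          ‖x - y‖ₑ ^ n := by
          gcongr
          refine (hA.monotone (nnnorm_sum_div_le σ Φ N b l x y)).trans (hA.map_sum_le _ _ _ ?_)
          rw [← Finset.sum_div]
          exact div_le_one_of_le₀ ((hS x y N).trans hSl) zero_le
      _ = _ := by
          rw [ENNReal.div_eq_inv_mul, Finset.mul_sum]
          refine Finset.sum_congr rfl fun k _ => ?_
          rw [ENNReal.coe_div hl.ne']
          simp only [div_eq_mul_inv]
          ring
  calc fracModular σ A _
      ≤ ∫⁻ x, ∫⁻ y, ∑ k ∈ Finset.range N,
          A (b k) / l * ((G k x y : ℝ≥0∞) / ‖x - y‖ₑ ^ n) :=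
        lintegral_mono fun x => lintegral_mono fun y => hpt x y
    _ = ∑ k ∈ Finset.range N, A (b k) / l * (2 ^ (k * n) * gagliardo σ Φ) := by
        rw [lintegral_lintegral_sum_const_mul _ _ fun k =>
          measurable_diffQuot_div σ hΦ ((2 : ℝ) ^ k)⁻¹]
        exact Finset.sum_congr rfl fun k _ => by rw [lintegral_diffQuot_smul]
    _ ≤ ∑ k ∈ Finset.range N, A (b k) * 2 ^ (k * n) := by
        refine Finset.sum_le_sum fun k _ => ?_
        calc A (b k) / l * (2 ^ (k * n) * gagliardo σ Φ)
            ≤ A (b k) / l * (2 ^ (k * n) * l) := by gcongr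
          _ = A (b k) * 2 ^ (k * n) * ((l : ℝ≥0∞)⁻¹ * l) := by
            rw [div_eq_mul_inv]
            ring
          _ = _ := by rw [ENNReal.inv_mul_cancel hl0 ENNReal.coe_ne_top, mul_one]
    _ ≤ 1 := hb

end Modular

/-! ### From the embedding to the discrete inequality -/

section Embedding

variable {n : ℕ} {s : ℝ} {A : ℝ≥0 → ℝ≥0∞}

theorem exists_discreteBound (hn : 0 < n) (hs : 0 < s) (hsN : ∀ k : ℕ, s ≠ k) (hA : IsYoung A)
    {Y : RISpace n} (hY : Embeds s A Y) : ∃ C : ℝ≥0, DiscreteBound n s A C := by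
  set m := ⌊s⌋₊
  set σ := Int.fract s
  have hsm : s = m + σ := by
    rw [show (m : ℝ) = (⌊s⌋ : ℝ) from natCast_floor_eq_intCast_floor hs.le]
    exact (Int.floor_add_fract s).symm
  -- Here `s ∉ ℕ` is essential: the dyadic sums need `σ > 0`.
  have h0 : 0 < σ := by
    refine lt_of_le_of_ne (Int.fract_nonneg s) fun h => hsN m ?_
    rw [← h, add_zero] at hsm
    exact hsm
  have h1 : σ < 1 := Int.fract_lt_one s
  obtain ⟨φ, hφ0, hφ1⟩ : ∃ φ : Eucl n → ℝ, IsTest φ ∧ ∀ x, ‖x‖ ≤ 1 → φ x = 1 := by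
    let f : ContDiffBump (0 : Eucl n) := ⟨1, 2, one_pos, one_lt_two⟩
    exact ⟨f, ⟨f.contDiff, f.hasCompactSupport⟩, fun x hx =>
      f.one_of_mem_closedBall (mem_closedBall_zero_iff.2 hx)⟩
  set Φ := revGrad m φ
  obtain ⟨L, R, hΦ⟩ := exists_isBumpLike ((hφ0.contDiff_revGrad m).of_le (by simp))
    (hφ0.exists_revGrad_eq_zero m)
  obtain ⟨S, hS⟩ := hΦ.exists_sum_diffQuot_le h0 h1
  have hK := hΦ.gagliardo_lt_top hn h0 h1
  set l : ℝ≥0 := S + (gagliardo σ Φ).toNNReal + 1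
  have hl : 0 < l := by positivity
  have hSl : S ≤ l := by
    rw [show l = S + ((gagliardo σ Φ).toNNReal + 1) from add_assoc _ _ _]
    exact le_self_add
  have hKl : gagliardo σ Φ ≤ l := by
    rw [← ENNReal.coe_toNNReal hK.ne, ENNReal.coe_le_coe]
    exact le_add_self.trans le_self_add
  obtain ⟨c, hc⟩ := hY
  set B : Set (Eucl n) := Metric.ball 0 1
  obtain ⟨D, hD⟩ := Y.integral_le B measurableSet_ball measure_ball_lt_top
  have hB0 : (volume B).toNNReal ≠ 0 := by
    rw [Ne, ENNReal.toNNReal_eq_zero_iff, not_or]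
    exact ⟨(Metric.measure_ball_pos volume _ one_pos).ne', measure_ball_lt_top.ne⟩
  refine ⟨D * (c * l) / (volume B).toNNReal, fun N b hb => ?_⟩
  -- Differentiating `m` times costs `2^{-km}`, so `2^{sk}` leaves the factor `2^{kσ}` in the
  -- gradient.
  set a : ℕ → ℝ≥0 := fun k => b k * ((2 : ℝ≥0) ^ s) ^ k
  set u : Eucl n → ℝ := dilSum (Finset.range N) (fun k => (a k : ℝ)) (fun k => ((2 : ℝ) ^ k)⁻¹) φ
  have hu : IsTest u := hφ0.dilSum _ _ _ fun k => by positivity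
  have hgrad : revGrad m u = fun x => ∑ k ∈ Finset.range N,
      ((b k : ℝ) * ((2 : ℝ) ^ k) ^ σ) • Φ (((2 : ℝ) ^ k)⁻¹ • x) := by
    funext x
    rw [revGrad_dilSum _ _ _ hφ0]
    refine Finset.sum_congr rfl fun k _ => ?_
    congr 1
    have h2k : (0 : ℝ) < 2 ^ k := by positivity
    have e : ((2 : ℝ) ^ s) ^ k = ((2 : ℝ) ^ k) ^ m * ((2 : ℝ) ^ k) ^ σ := by
      rw [← Real.rpow_natCast _ m, ← Real.rpow_add h2k, ← hsm, ← Real.rpow_natCast,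
        ← Real.rpow_natCast, ← Real.rpow_mul two_pos.le, ← Real.rpow_mul two_pos.le, mul_comm]
    simp only [a, NNReal.coe_mul, NNReal.coe_pow, NNReal.coe_rpow, NNReal.coe_ofNat, e]
    rw [inv_pow]
    field_simp
  have hsemi : sobolevSeminorm s A u ≤ l := by
    refine iInf_le_of_le l (iInf_le_of_le hl (iInf_le_of_le ?_ le_rfl))
    have hae : (fun x => (l : ℝ)⁻¹ • weakGrad m u x) =ᵐ[volume]
        fun x => (l : ℝ)⁻¹ • revGrad m u x :=
      (hu.weakGrad_ae_eq m).mono fun x hx => congrArg ((l : ℝ)⁻¹ • ·) hx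
    change fracModular σ A (fun x => (l : ℝ)⁻¹ • weakGrad m u x) ≤ 1
    rw [fracModular_congr hae, hgrad]
    exact fracModular_sum_le_one hA hΦ.continuous hS hl hSl hKl N b hb
  have hmem : u ∈ spaceVd n s A :=
    ⟨⟨hu.smooth.continuous.aemeasurable, hu.weaklyDiff m, hsemi.trans_lt ENNReal.coe_lt_top⟩,
      fun k _ t ht => hu.volume_weakGrad_lt_top k ht⟩
  have hle : ∫⁻ x in B, ‖u x‖ₑ ≤ D * (c * l) := by
    calc ∫⁻ x in B, ‖u x‖ₑ ≤ D * Y.normFun u := hD _ hu.smooth.continuous.enorm.aemeasurable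
      _ ≤ D * (c * l) := by
        gcongr
        exact (hc u hmem).2.trans (by gcongr)
  -- Contraction by `2^{-k} ≤ 1` keeps the unit ball inside itself, where `φ = 1`.
  have huB : ∫⁻ x in B, ‖u x‖ₑ = ((∑ k ∈ Finset.range N, a k : ℝ≥0) : ℝ≥0∞) * volume B := by
    rw [← setLIntegral_const]
    refine setLIntegral_congr_fun measurableSet_ball fun x hx => ?_
    have hux : u x = ((∑ k ∈ Finset.range N, a k : ℝ≥0) : ℝ) := by
      rw [NNReal.coe_sum]
      refine Finset.sum_congr rfl fun k _ => ?_
      rw [hφ1, mul_one]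
      rw [norm_smul, Real.norm_of_nonneg (by positivity)]
      exact mul_le_one₀ (inv_le_one_of_one_le₀ (one_le_pow₀ one_le_two)) (norm_nonneg _)
        (mem_ball_zero_iff.1 hx).le
    simp only [hux]
    exact Real.enorm_of_nonneg (NNReal.coe_nonneg _) |>.trans (ENNReal.ofReal_coe_nnreal)
  rw [huB, ← ENNReal.coe_toNNReal (measure_ball_lt_top (x := (0 : Eucl n)) (r := 1)).ne] at hle
  rw [le_div_iff₀ (pos_iff_ne_zero.2 hB0)]
  exact_mod_cast hle

end Embedding

end FracOrlicz

theorem theorem3p1 (n : ℕ) (hn : 0 < n) (s : ℝ) (hs : 0 < s) (hsN : ∀ k : ℕ, s ≠ k)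
    (A : ℝ≥0 → ℝ≥0∞) (hA : FracOrlicz.IsYoung A)
    (hY : ∃ Y : FracOrlicz.RISpace n, FracOrlicz.Embeds s A Y) :
    s < n ∧
      ∃ δ : ℝ, 0 < δ ∧
        ∫⁻ t in Set.Ioc 0 δ, (ENNReal.ofReal t / A t.toNNReal) ^ (s / (n - s)) < ∞ := by
  obtain ⟨Y, hY⟩ := hY
  obtain ⟨C, hC⟩ := FracOrlicz.exists_discreteBound hn hs hsN hA hY
  -- The borderline `s = n` is excluded only because `s` is not an integer.
  have hsn : s < n := lt_of_le_of_ne (hC.le hA) (hsN n)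
  exact ⟨hsn, 1, one_pos, hC.lintegral_lt_top hA hs hsn⟩
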